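/- For a finite connected graph $H$ let $\mathscr K(H)=\sum_j \pi_j m_{ij}$ denote Kemeny's constant of the simple random walk on $H$ (which moves from a vertex to a uniformly chosen neighbour), where $\pi$ is its stationary distribution and $m_{ij}$ is the expected time at which the walk started at $i$ first visits $j$ (so $m_{jj}=0$). For connected $H$ with at least one edge, $\pi$ is unique and the sum is finite and does not depend on $i$. Theorem. Let $G$ be a finite simple connected graph with $m=|E(G)|\ge 1$ edges, and let $v\in V(G)$. Let $\bar G$ be the graph obtained from $G$ by attaching three new pendant vertices $a,b,c$ to $v$; let $\widetilde G$ be obtained from $\bar G$ by adding the edge $ab$, let $\widehat G$ be obtained from $\widetilde G$ by adding the edge $bc$, and let $G^*$ be obtained from $\widehat G$ by adding the edge $ac$ (so that $v,a,b,c$ induce a $K_4$ in $G^*$). Then Kemeny's constant is well defined (one stationary distribution; a finite sum, the same for every $i$) for each of these four graphs, and 1. $\mathscr K(G^*)\ge\mathscr K(\bar G)$, with equality if and only if $G$ is (isomorphic to) the path $P_2$ on two vertices; 2. $\mathscr K(\widehat G)>\mathscr K(\bar G)$; 3. if $m\ge 2$, then $\mathscr K(G^*)>\mathscr K(\widehat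 G)$; 4. if $m\ge 4$, then $\mathscr K(\widehat G)>\mathscr K(\widetilde G)$; 5. if $m\ge 4$, then $\mathscr K(G^*)>\mathscr K(\widetilde G)$. -/

import Mathlib

open scoped NNReal ENNReal

namespace Kemeny

open Classical in
/-- The transition matrix of the simple random walk on a finite graph: from `i` the walk moves to a
uniformly chosen neighbour of `i`. -/
noncomputable def walkMatrix {V : Type*} [Fintype V] (G : SimpleGraph V) : Matrix V V ℝ≥0 :=
  fun i j => if G.Adj i j then ((G.degree i : ℕ) : ℝ≥0)⁻¹ else 0

/-- `π` is a stationary distribution of the Markov chain with transition matrix `P`. -/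
structure IsStationary {V : Type*} [Fintype V] (P : Matrix V V ℝ≥0) (π : V → ℝ≥0) : Prop where
  sum_eq_one : ∑ j, π j = 1
  invariant : Matrix.vecMul π P = π

open Classical in
/-- The probability that the Markov chain `X` with transition matrix `P` and `X₀ = i` satisfies
`X₀ ≠ j, …, X_t ≠ j`, that is `ℙ_i(T_j > t)` for the hitting time `T_j = inf {s ≥ 0 | X_s = j}`:
the sum, over all trajectories `w₀, …, w_t` that start at `i` and avoid `j`, of their
probabilities. -/
noncomputable def survivalProb {V : Type*} [Fintype V] (P : Matrix V V ℝ≥0) (i j : V) (t : ℕ) :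
    ℝ≥0 :=
  ∑ w : Fin (t + 1) → V with w 0 = i ∧ ∀ s, w s ≠ j, ∏ s : Fin t, P (w s.castSucc) (w s.succ)

/-- The expected hitting time `m_{ij} = 𝔼_i[T_j] = ∑_{t ≥ 0} ℙ_i(T_j > t)`, with value in `[0, ∞]`
(so `m_{jj} = 0`). -/
noncomputable def hittingTime {V : Type*} [Fintype V] (P : Matrix V V ℝ≥0) (i j : V) : ℝ≥0∞ :=
  ∑' t : ℕ, (survivalProb P i j t : ℝ≥0∞)

/-- `κ` is Kemeny's constant of the Markov chain `P`: there is exactly one stationary distribution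
`π`, and `∑_j π_j m_{ij} = κ` for every initial state `i`. For a nonempty state space there is at
most one such `κ`. -/
def IsKemenyConstant {V : Type*} [Fintype V] (P : Matrix V V ℝ≥0) (κ : ℝ≥0) : Prop :=
  (∃! π : V → ℝ≥0, IsStationary P π) ∧
    ∀ π : V → ℝ≥0, IsStationary P π →
      ∀ i, ∑ j, (π j : ℝ≥0∞) * hittingTime P i j = (κ : ℝ≥0∞)

/-- The graph `Ḡ`: three new vertices `a = inr 0`, `b = inr 1`, `c = inr 2`, each of them joined to
`v` and to nothing else. -/
def graphBar {V : Type*} (G : SimpleGraph V) (v : V) : SimpleGraph (V ⊕ Fin 3) where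
  Adj
    | Sum.inl x, Sum.inl y => G.Adj x y
    | Sum.inl x, Sum.inr _ => x = v
    | Sum.inr _, Sum.inl y => y = v
    | Sum.inr _, Sum.inr _ => False
  symm := ⟨by
    rintro (x | x) (y | y) h
    · exact G.adj_symm h
    · exact h
    · exact h
    · exact h⟩
  loopless := ⟨by
    rintro (x | x) h
    · exact G.irrefl h
    · exact h⟩

/-- The graph `G̃`: the edge `ab` is added to `Ḡ`. -/
def graphTilde {V : Type*} (G : SimpleGraph V) (v : V) : SimpleGraph (V ⊕ Fin 3) :=
  graphBar G v ⊔ SimpleGraph.edge (Sum.inr 0) (Sum.inr 1)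

/-- The graph `Ĝ`: the edge `bc` is added to `G̃`. -/
def graphHat {V : Type*} (G : SimpleGraph V) (v : V) : SimpleGraph (V ⊕ Fin 3) :=
  graphTilde G v ⊔ SimpleGraph.edge (Sum.inr 1) (Sum.inr 2)

/-- The graph `G*`: the edge `ac` is added to `Ĝ`. -/
def graphStar {V : Type*} (G : SimpleGraph V) (v : V) : SimpleGraph (V ⊕ Fin 3) :=
  graphHat G v ⊔ SimpleGraph.edge (Sum.inr 0) (Sum.inr 2)

end Kemeny

/-! Kemeny's constant can be read off a Green function g grounded at any vertex v: with d the
degrees and W = 2m, it equals ∑ d_x g(x,x) − (1/W) ∑ d_x g(x,y) d_y (`isKemenyConstant_of_isGreen`).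
In all four graphs v separates G from the new vertices, so the Green function grounded at v is block
diagonal (`IsConeGluing.isGreen`). Its second block is the inverse of I + L_B, where B is the graph
on a, b, c. Each constant is thus T + T_B − (S + S_B)/(2m + W_B), where T and S come from G alone
and the other numbers are explicit. In differences T cancels, leaving a numerator that is quadratic
in m and increasing in S. Since S is the degree-weighted sum of hitting times of v, S ≥ 2m − d_v ≥ m
(`sum_deg_sub_le_greenForm`), and S = 1 when m = 1. This settles every comparison. -/

namespace Kemeny

/-! ### Hitting times and first-step equations. -/

section HittingTimes

variable {V : Type*} [Fintype V]

open Classical in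
theorem survivalProb_zero (P : Matrix V V ℝ≥0) (i j : V) :
    survivalProb P i j 0 = if i = j then 0 else 1 := by
  unfold survivalProb
  rw [Finset.sum_filter, Fintype.sum_equiv (Equiv.funUnique (Fin 1) V) _
    (fun x => if x = i ∧ x ≠ j then 1 else 0)]
  · by_cases h : i = j
    · subst h
      simp
    · rw [Finset.sum_eq_single i] <;> simp +contextual [h]
  · intro w
    simp

open Classical in
theorem survivalProb_succ (P : Matrix V V ℝ≥0) (i j : V) (t : ℕ) :
    survivalProb P i j (t + 1) = if i = j then 0 else ∑ k, P i k * survivalProb P k j t := by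
  unfold survivalProb
  rw [Finset.sum_filter, ← (Fin.consEquiv (fun _ : Fin (t + 2) => V)).sum_comp,
    Fintype.sum_prod_type, Finset.sum_eq_single i]
  · by_cases h : i = j
    · simp [h, Fin.consEquiv, Fin.forall_fin_succ]
    · simp only [h, if_false, Finset.mul_sum, Finset.sum_filter]
      rw [Finset.sum_comm]
      refine Finset.sum_congr rfl fun w _ => ?_
      rw [Finset.sum_eq_single (w 0)]
      · have hw : (∀ s, ¬ (Fin.cons i w : Fin (t + 2) → V) s = j) ↔ ∀ s, ¬ w s = j := by
          rw [Fin.forall_fin_succ]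
          simp [h]
        simp [Fin.consEquiv, Fin.prod_univ_succ, hw]
      · intro b _ hb
        simp [hb.symm]
      · simp
  · intro b _ hb
    simp [Fin.consEquiv, hb]
  · simp

/-- A solution of the first-step equations of a stochastic matrix is nonnegative. -/
theorem nonneg_of_first_step {P : Matrix V V ℝ≥0} (hP : ∀ i, ∑ k, P i k = 1) {u : V → ℝ} {j : V}
    (hj : u j = 0) (hu : ∀ i, i ≠ j → u i = 1 + ∑ k, (P i k : ℝ) * u k) (i : V) : 0 ≤ u i := by
  have : Nonempty V := ⟨j⟩
  -- Minimum principle: a minimiser a ≠ j would satisfy u a ≥ 1 + u a.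
  obtain ⟨a, ha⟩ := Finite.exists_min u
  by_cases haj : a = j
  · rw [← hj, ← haj]
    exact ha i
  · exfalso
    have h1 : ∑ k, (P a k : ℝ) * u a ≤ ∑ k, (P a k : ℝ) * u k :=
      Finset.sum_le_sum fun k _ => mul_le_mul_of_nonneg_left (ha k) (P a k).2
    rw [← Finset.sum_mul, ← NNReal.coe_sum, hP a, NNReal.coe_one, one_mul] at h1
    linarith [hu a haj]

/-- The expected hitting times are the solution of the first-step equations. -/
theorem hittingTime_eq {P : Matrix V V ℝ≥0} (hP : ∀ i, ∑ k, P i k = 1) {u : V → ℝ} {j : V}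
    (hj : u j = 0) (hu : ∀ i, i ≠ j → u i = 1 + ∑ k, (P i k : ℝ) * u k) (i : V) :
    hittingTime P i j = ENNReal.ofReal (u i) := by
  classical
  have h0 := nonneg_of_first_step hP hj hu
  set s : ℕ → V → ℝ := fun t i => (survivalProb P i j t : ℝ) with hs
  have s0 : ∀ i, s 0 i = if i = j then 0 else 1 := fun i => by
    simp only [hs, survivalProb_zero]; split_ifs <;> simp
  have s1 : ∀ t i, s (t + 1) i = if i = j then 0 else ∑ k, (P i k : ℝ) * s t k := fun t i => by
    simp only [hs, survivalProb_succ]; split_ifs <;> simp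
  have sj : ∀ t, s t j = 0 := fun t => by cases t <;> simp [s0, s1]
  have hT : ∀ n i, i ≠ j → ∑ t ∈ Finset.range (n + 1), s t i =
      1 + ∑ k, (P i k : ℝ) * ∑ t ∈ Finset.range n, s t k := fun n i hi => by
    rw [Finset.sum_range_succ', s0, if_neg hi, add_comm]
    congr 1
    simp only [Finset.mul_sum]
    rw [Finset.sum_comm]
    exact Finset.sum_congr rfl fun t _ => by rw [s1, if_neg hi]
  have hle : ∀ n i, ∑ t ∈ Finset.range n, s t i ≤ u i := by
    intro n
    induction n with
    | zero => intro i; simpa using h0 i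
    | succ n ih =>
      intro i
      by_cases hi : i = j
      · subst hi
        simp [sj, hj]
      · rw [hT n i hi, hu i hi]
        gcongr with k
        exact ih k
  obtain ⟨C, hC⟩ := (Set.finite_range u).bddAbove
  have hC' : ∀ i, u i ≤ C := fun i => hC ⟨i, rfl⟩
  -- The remainder is the expected value of u at time n on survival, at most sup u times the
  -- survival probability. That probability tends to 0 because `hle` makes it summable.
  have hge : ∀ n i, u i - ∑ t ∈ Finset.range n, s t i ≤ C * s n i := by
    intro n
    induction n with
    | zero =>
      intro i
      by_cases hi : i = j
      · simp [s0, hi, hj]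
      · simpa [s0, hi] using hC' i
    | succ n ih =>
      intro i
      by_cases hi : i = j
      · subst hi
        simp [sj, hj]
      · rw [hT n i hi, hu i hi, s1, if_neg hi, Finset.mul_sum, add_sub_add_left_eq_sub,
          ← Finset.sum_sub_distrib]
        refine Finset.sum_le_sum fun k _ => ?_
        have := mul_le_mul_of_nonneg_left (ih k) (P i k).2
        rwa [mul_sub, mul_left_comm] at this
  have hsn : ∀ t, 0 ≤ s t i := fun t => NNReal.coe_nonneg _
  have hsum : Summable fun t => s t i := summable_of_sum_range_le hsn fun n => hle n i
  have hlim : Filter.Tendsto (fun n => ∑ t ∈ Finset.range n, s t i) Filter.atTop (nhds (u i)) := by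
    refine tendsto_of_tendsto_of_tendsto_of_le_of_le
      (g := fun n => u i - C * s n i) ?_ tendsto_const_nhds (fun n => ?_) (fun n => hle n i)
    · simpa using tendsto_const_nhds.sub (hsum.tendsto_atTop_zero.const_mul C)
    · have := hge n i
      simp only
      linarith
  have htsum : ∑' t, s t i = u i := tendsto_nhds_unique hsum.hasSum.tendsto_sum_nat hlim
  rw [← htsum, ENNReal.ofReal_tsum_of_nonneg hsn hsum]
  exact tsum_congr fun t => by simp [hs]

end HittingTimes

/-! ### Laplacian and Green functions. -/

section GreenFunction

variable {V : Type*} [Fintype V]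

open Classical in
/-- The degree of a vertex, as a real number. -/
noncomputable def deg (G : SimpleGraph V) (x : V) : ℝ := ∑ z, if G.Adj x z then 1 else 0

open Classical in
/-- The combinatorial Laplacian `(Δf)(x) = ∑_{z ∼ x} (f x - f z)`. -/
noncomputable def lap (G : SimpleGraph V) (f : V → ℝ) (x : V) : ℝ :=
  ∑ z, if G.Adj x z then f x - f z else 0

open Classical in
/-- `g` is a Green function of `G` with pole at `v`: `Δg(·, y) = δ_y - δ_v` and `g(v, ·) = 0`. -/
structure IsGreen (G : SimpleGraph V) (v : V) (g : V → V → ℝ) : Prop where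
  lap_eq : ∀ x y, lap G (fun z => g z y) x = (if x = y then 1 else 0) - (if x = v then 1 else 0)
  ground : ∀ y, g v y = 0

/-- The sum `∑_x d_x g(x, x)`. -/
noncomputable def greenTrace (G : SimpleGraph V) (g : V → V → ℝ) : ℝ := ∑ x, deg G x * g x x

/-- The quadratic form `∑_{x, y} d_x g(x, y) d_y`. -/
noncomputable def greenForm (G : SimpleGraph V) (g : V → V → ℝ) : ℝ :=
  ∑ x, deg G x * ∑ y, g x y * deg G y

open Classical in
theorem deg_eq_degree (G : SimpleGraph V) (x : V) : deg G x = (G.degree x : ℝ) := by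
  rw [deg, Finset.sum_boole, ← SimpleGraph.card_neighborFinset_eq_degree,
    SimpleGraph.neighborFinset_eq_filter]

open Classical in
theorem sum_walkMatrix_mul (G : SimpleGraph V) (f : V → ℝ) (x : V) :
    ∑ z, (walkMatrix G x z : ℝ) * f z = (deg G x)⁻¹ * ∑ z, if G.Adj x z then f z else 0 := by
  rw [Finset.mul_sum]
  refine Finset.sum_congr rfl fun z _ => ?_
  unfold walkMatrix
  split_ifs <;> simp [deg_eq_degree]

open Classical in
theorem lap_eq_sub (G : SimpleGraph V) (f : V → ℝ) (x : V) :
    lap G f x = deg G x * f x - ∑ z, if G.Adj x z then f z else 0 := by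
  rw [deg, lap, Finset.sum_mul, ← Finset.sum_sub_distrib]
  refine Finset.sum_congr rfl fun z _ => ?_
  split_ifs <;> simp

theorem deg_pos {G : SimpleGraph V} (hG : G.Connected) [Nontrivial V] (x : V) : 0 < deg G x := by
  classical
  rw [deg_eq_degree]
  exact_mod_cast hG.preconnected.degree_pos_of_nontrivial x

theorem lap_add (G : SimpleGraph V) (f₁ f₂ : V → ℝ) (x : V) :
    lap G (fun z => f₁ z + f₂ z) x = lap G f₁ x + lap G f₂ x := by
  unfold lap
  rw [← Finset.sum_add_distrib]
  refine Finset.sum_congr rfl fun z _ => ?_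
  split_ifs <;> ring

theorem lap_sub (G : SimpleGraph V) (f₁ f₂ : V → ℝ) (x : V) :
    lap G (fun z => f₁ z - f₂ z) x = lap G f₁ x - lap G f₂ x := by
  unfold lap
  rw [← Finset.sum_sub_distrib]
  refine Finset.sum_congr rfl fun z _ => ?_
  split_ifs <;> ring

theorem lap_mul_const (G : SimpleGraph V) (f : V → ℝ) (c : ℝ) (x : V) :
    lap G (fun z => f z * c) x = lap G f x * c := by
  unfold lap
  rw [Finset.sum_mul]
  refine Finset.sum_congr rfl fun z _ => ?_
  split_ifs <;> ring

theorem lap_const (G : SimpleGraph V) (c : ℝ) (x : V) : lap G (fun _ => c) x = 0 := by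
  simp [lap]

theorem lap_sum (G : SimpleGraph V) {ι : Type*} (s : Finset ι) (f : ι → V → ℝ) (x : V) :
    lap G (fun z => ∑ i ∈ s, f i z) x = ∑ i ∈ s, lap G (f i) x := by
  unfold lap
  rw [Finset.sum_comm]
  refine Finset.sum_congr rfl fun z _ => ?_
  split_ifs <;> simp

theorem sum_lap (G : SimpleGraph V) (f : V → ℝ) : ∑ x, lap G f x = 0 := by
  have h : ∑ x, lap G f x = -∑ x, lap G f x := by
    conv_lhs => unfold lap
    rw [Finset.sum_comm, ← Finset.sum_neg_distrib]
    refine Finset.sum_congr rfl fun x _ => ?_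
    rw [lap, ← Finset.sum_neg_distrib]
    refine Finset.sum_congr rfl fun z _ => ?_
    by_cases h : G.Adj x z
    · simp [h, h.symm]
    · simp [h, mt G.adj_symm h]
  linarith

theorem eq_of_lap_eq_zero {G : SimpleGraph V} (hG : G.Connected) {f : V → ℝ}
    (hf : ∀ x, lap G f x = 0) (x y : V) : f x = f y := by
  classical
  refine (SimpleGraph.lapMatrix_mulVec_eq_zero_iff_forall_reachable (G := G)).1 ?_ x y
    (hG.preconnected x y)
  funext z
  rw [SimpleGraph.lapMatrix_mulVec_apply, Pi.zero_apply, ← hf z, lap_eq_sub, deg_eq_degree,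
    SimpleGraph.neighborFinset_eq_filter, Finset.sum_filter]

/-- The Laplacian becomes invertible once f(v)δ_v is added. The preimage of δ_y takes the value 1 at
v, so subtracting 1 grounds it. -/
theorem exists_isGreen {G : SimpleGraph V} (hG : G.Connected) (v : V) : ∃ g, IsGreen G v g := by
  classical
  let T : (V → ℝ) →ₗ[ℝ] (V → ℝ) :=
    { toFun := fun f x => lap G f x + if x = v then f v else 0
      map_add' := fun f₁ f₂ => by
        funext x
        have := lap_add G f₁ f₂ x
        simp only [Pi.add_apply]
        change lap G (fun z => f₁ z + f₂ z) x + _ = _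
        rw [this]
        split_ifs <;> ring
      map_smul' := fun c f => by
        funext x
        have := lap_mul_const G f c x
        simp only [Pi.smul_apply, smul_eq_mul, RingHom.id_apply]
        have e : (c • f) = fun z => f z * c := funext fun z => mul_comm _ _
        rw [e, this]
        split_ifs <;> ring }
  have hTsum : ∀ f, ∑ x, T f x = f v := fun f => by
    change ∑ x, (lap G f x + if x = v then f v else 0) = f v
    rw [Finset.sum_add_distrib, sum_lap]
    simp
  have hinj : Function.Injective T := by
    rw [← LinearMap.ker_eq_bot, LinearMap.ker_eq_bot']
    intro f hf
    have hv : f v = 0 := by rw [← hTsum f, hf]; simp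
    have hl : ∀ x, lap G f x = 0 := fun x => by
      have : lap G f x + (if x = v then f v else 0) = 0 := congrFun hf x
      simpa [hv] using this
    funext x
    rw [eq_of_lap_eq_zero hG hl x v, hv, Pi.zero_apply]
  have hsurj := LinearMap.injective_iff_surjective.1 hinj
  choose g hg using fun y => hsurj (Pi.single y 1)
  have hgv : ∀ y, g y v = 1 := fun y => by rw [← hTsum (g y), hg]; simp
  refine ⟨fun x y => g y x - 1, fun x y => ?_, fun y => by simp [hgv]⟩
  have h : lap G (g y) x + (if x = v then g y v else 0) = Pi.single (M := fun _ => ℝ) y 1 x :=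
    congrFun (hg y) x
  rw [lap_sub, lap_const, sub_zero, eq_sub_of_add_eq h, hgv, Pi.single_apply]

end GreenFunction

/-! ### Stationary distribution and Kemeny's constant. -/

section KemenyFormula

variable {V : Type*} [Fintype V]

theorem sum_walkMatrix {G : SimpleGraph V} (hd : ∀ x, 0 < deg G x) (x : V) :
    ∑ z, walkMatrix G x z = 1 := by
  have h := sum_walkMatrix_mul G (fun _ => 1) x
  simp only [mul_one] at h
  change _ = (deg G x)⁻¹ * deg G x at h
  rw [inv_mul_cancel₀ (hd x).ne'] at h
  exact_mod_cast h

theorem hittingTime_walkMatrix {G : SimpleGraph V} (hd : ∀ x, 0 < deg G x) {u : V → ℝ} {j : V}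
    (hj : u j = 0) (hu : ∀ x, x ≠ j → lap G u x = deg G x) (x : V) :
    0 ≤ u x ∧ hittingTime (walkMatrix G) x j = ENNReal.ofReal (u x) := by
  have key : ∀ x, x ≠ j → u x = 1 + ∑ k, (walkMatrix G x k : ℝ) * u k := fun x hx => by
    have := hu x hx
    rw [lap_eq_sub] at this
    rw [sum_walkMatrix_mul]
    have := (hd x).ne'
    field_simp
    linarith
  exact ⟨nonneg_of_first_step (sum_walkMatrix hd) hj key x,
    hittingTime_eq (sum_walkMatrix hd) hj key x⟩

/-- Invariance of π says that π/d is harmonic, hence constant by connectedness. -/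
theorem isStationary_iff {G : SimpleGraph V} (hG : G.Connected) (hd : ∀ x, 0 < deg G x)
    (π : V → ℝ≥0) :
    IsStationary (walkMatrix G) π ↔ ∀ x, (π x : ℝ) = deg G x / ∑ y, deg G y := by
  classical
  have : Nonempty V := hG.nonempty
  have hW : 0 < ∑ y, deg G y := Finset.sum_pos (fun y _ => hd y) Finset.univ_nonempty
  have hq : ∀ x, ((Matrix.vecMul π (walkMatrix G) x : ℝ≥0) : ℝ) - π x =
      -lap G (fun y => (π y : ℝ) / deg G y) x := fun x => by
    rw [lap_eq_sub, mul_div_cancel₀ _ (hd x).ne']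
    simp only [Matrix.vecMul, dotProduct, NNReal.coe_sum, NNReal.coe_mul, neg_sub]
    congr 1
    refine Finset.sum_congr rfl fun y _ => ?_
    simp only [walkMatrix, G.adj_comm x y]
    split_ifs <;> simp [deg_eq_degree, div_eq_mul_inv]
  constructor
  · intro h x
    have hl : ∀ x, lap G (fun y => (π y : ℝ) / deg G y) x = 0 := fun x => by
      have := hq x
      rw [h.invariant, sub_self] at this
      linarith
    have hc := fun y => eq_of_lap_eq_zero hG hl y x
    have hs : ∑ y, (π y : ℝ) = 1 := by exact_mod_cast h.sum_eq_one
    have : ∀ y, (π y : ℝ) = π x / deg G x * deg G y := fun y => by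
      rw [← hc y, div_mul_cancel₀ _ (hd y).ne']
    rw [Finset.sum_congr rfl fun y _ => this y, ← Finset.mul_sum] at hs
    have hx := (hd x).ne'
    field_simp at hs ⊢
    linarith
  · intro h
    refine ⟨?_, ?_⟩
    · have : ∑ y, (π y : ℝ) = 1 := by
        rw [Finset.sum_congr rfl fun y _ => h y, ← Finset.sum_div, div_self hW.ne']
      exact_mod_cast this
    · funext x
      have e : (fun y => (π y : ℝ) / deg G y) = fun _ => (∑ y, deg G y)⁻¹ := by
        funext y
        have := (hd y).ne'
        rw [h y]
        field_simp
      have := hq x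
      rw [e, lap_const, neg_zero, sub_eq_zero] at this
      exact_mod_cast this

/-- Kemeny's constant in terms of a Green function. -/
theorem isKemenyConstant_of_isGreen {G : SimpleGraph V} (hG : G.Connected)
    (hd : ∀ x, 0 < deg G x) {v : V} {g : V → V → ℝ} (hg : IsGreen G v g) :
    0 ≤ greenTrace G g - greenForm G g / ∑ x, deg G x ∧
    IsKemenyConstant (walkMatrix G)
      (Real.toNNReal (greenTrace G g - greenForm G g / ∑ x, deg G x)) := by
  classical
  have hne : Nonempty V := hG.nonempty
  set W := ∑ x, deg G x with hWdef
  have hW : 0 < W := Finset.sum_pos (fun y _ => hd y) Finset.univ_nonempty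
  -- The hitting time of j from i: the δ_v terms cancel in its Laplacian, leaving d − Wδ_j.
  let u : V → V → ℝ := fun j i => ∑ k, (g j j - g i j - g j k + g i k) * deg G k
  have hu0 : ∀ j, u j j = 0 := fun j => by simp [u]
  have hul : ∀ j x, lap G (u j) x = deg G x - if x = j then W else 0 := fun j x => by
    have e : ∀ k, lap G (fun z => (g j j - g z j - g j k + g z k) * deg G k) x =
        ((if x = k then 1 else 0) - if x = j then 1 else 0) * deg G k := fun k => by
      rw [lap_mul_const, lap_add, lap_sub, lap_sub, lap_const, lap_const, hg.lap_eq, hg.lap_eq]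
      ring
    rw [lap_sum, Finset.sum_congr rfl fun k _ => e k]
    simp only [sub_mul, Finset.sum_sub_distrib, ite_mul, one_mul, zero_mul]
    split_ifs <;> simp [hWdef]
  have hhit := fun j => hittingTime_walkMatrix hd (hu0 j) fun x hx => by rw [hul]; simp [hx]
  -- The two terms that depend on i cancel after averaging over j.
  have hsum : ∀ i, ∑ j, deg G j / W * u j i = greenTrace G g - greenForm G g / W := fun i => by
    have e : ∀ j, u j i = W * g j j - W * g i j - ∑ k, g j k * deg G k + ∑ k, g i k * deg G k :=
      fun j => by
        simp only [u, sub_mul, add_mul, Finset.sum_sub_distrib, Finset.sum_add_distrib,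
          ← Finset.mul_sum, hWdef]
        ring
    have e2 : ∀ j, deg G j / W * u j i = deg G j * g j j - g i j * deg G j -
        deg G j * (∑ k, g j k * deg G k) / W + deg G j * ((∑ k, g i k * deg G k) / W) :=
      fun j => by
        rw [e]
        field_simp
    rw [Finset.sum_congr rfl fun j _ => e2 j, Finset.sum_add_distrib, Finset.sum_sub_distrib,
      Finset.sum_sub_distrib, ← Finset.sum_mul, ← Finset.sum_div, ← hWdef,
      mul_div_cancel₀ _ hW.ne', greenTrace, greenForm]
    ring
  have hnn : ∀ i j, 0 ≤ deg G j / W * u j i := fun i j =>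
    mul_nonneg (div_nonneg (hd j).le hW.le) (hhit j i).1
  refine ⟨?_, ?_, ?_⟩
  · rw [← hsum hne.some]
    exact Finset.sum_nonneg fun j _ => hnn _ j
  · refine ⟨fun x => Real.toNNReal (deg G x / W), ?_, fun π hπ => ?_⟩
    · exact (isStationary_iff hG hd _).2 fun x => Real.coe_toNNReal _ (div_nonneg (hd x).le hW.le)
    · funext x
      rw [← (isStationary_iff hG hd π).1 hπ x, Real.toNNReal_coe]
  · intro π hπ i
    rw [← hsum i]
    change _ = ENNReal.ofReal _
    rw [ENNReal.ofReal_sum_of_nonneg fun j _ => hnn i j]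
    refine Finset.sum_congr rfl fun j _ => ?_
    rw [ENNReal.ofReal_mul (div_nonneg (hd j).le hW.le), (hhit j i).2,
      ← (isStationary_iff hG hd π).1 hπ j, ENNReal.ofReal_coe_nnreal]

end KemenyFormula

/-! ### Bounds from hitting times of the pole. -/

section HittingPole

variable {V : Type*} [Fintype V]

/-- Identifies ∑_y g(·,y) d_y as the expected hitting time of v. -/
theorem lap_sum_isGreen {G : SimpleGraph V} {v : V} {g : V → V → ℝ} (hg : IsGreen G v g)
    {x : V} (hx : x ≠ v) : lap G (fun z => ∑ y, g z y * deg G y) x = deg G x := by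
  classical
  rw [lap_sum, Finset.sum_congr rfl fun y _ => lap_mul_const G (fun z => g z y) (deg G y) x]
  simp [hg.lap_eq, hx]

/-- The quadratic form of the Green function is at least the number of darts missing the pole. -/
theorem sum_deg_sub_le_greenForm {G : SimpleGraph V} (hd : ∀ x, 0 < deg G x) {v : V}
    {g : V → V → ℝ} (hg : IsGreen G v g) : ∑ x, deg G x - deg G v ≤ greenForm G g := by
  classical
  set h : V → ℝ := fun x => ∑ y, g x y * deg G y with hh
  have hv : h v = 0 := by simp [hh, hg.ground]
  have h0 : ∀ x, 0 ≤ h x := fun x =>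
    (hittingTime_walkMatrix hd hv (fun x hx => lap_sum_isGreen hg hx) x).1
  have key : ∀ x, deg G x - (if x = v then deg G v else 0) ≤ deg G x * h x := fun x => by
    split_ifs with hx
    · rw [hx, hv]
      simp
    · have := lap_sum_isGreen hg hx
      rw [lap_eq_sub] at this
      have h1 : 0 ≤ ∑ z, if G.Adj x z then h z else 0 :=
        Finset.sum_nonneg fun z _ => by split_ifs <;> simp [h0]
      linarith
  have := Finset.sum_le_sum fun x (_ : x ∈ Finset.univ) => key x
  rw [Finset.sum_sub_distrib] at this
  simpa only [Finset.sum_ite_eq', Finset.mem_univ, if_true, Kemeny.greenForm] using this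

/-- If every vertex other than the pole has no neighbour other than the pole, the quadratic form
of the Green function is the number of darts missing the pole. -/
theorem greenForm_eq {G : SimpleGraph V} {v : V} {g : V → V → ℝ} (hg : IsGreen G v g)
    (hG : ∀ x y, x ≠ v → G.Adj x y → y = v) : greenForm G g = ∑ x, deg G x - deg G v := by
  classical
  set h : V → ℝ := fun x => ∑ y, g x y * deg G y with hh
  have hv : h v = 0 := by simp [hh, hg.ground]
  have key : ∀ x, deg G x * h x = deg G x - (if x = v then deg G v else 0) := fun x => by
    split_ifs with hx
    · rw [hx, hv]
      simp
    · have := lap_sum_isGreen hg hx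
      rw [lap_eq_sub] at this
      have h1 : (∑ z, if G.Adj x z then h z else 0) = 0 :=
        Finset.sum_eq_zero fun z _ => by
          split_ifs with hz
          · rw [hG x z hx hz, hv]
          · rfl
      linarith
  change ∑ x, deg G x * h x = _
  rw [Finset.sum_congr rfl fun x _ => key x, Finset.sum_sub_distrib]
  simp

end HittingPole

/-! ### Gluing at a cut vertex. -/

section Gluing

variable {V ι : Type*}

/-- `H` is obtained from `G` and `B` by joining the vertex `v` of `G` to all vertices of `B`. -/
structure IsConeGluing (G : SimpleGraph V) (v : V) (B : SimpleGraph ι)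
    (H : SimpleGraph (V ⊕ ι)) : Prop where
  inl_inl : ∀ x y, H.Adj (Sum.inl x) (Sum.inl y) ↔ G.Adj x y
  inl_inr : ∀ x k, H.Adj (Sum.inl x) (Sum.inr k) ↔ x = v
  inr_inr : ∀ k l, H.Adj (Sum.inr k) (Sum.inr l) ↔ B.Adj k l

/-- The block-diagonal matrix with blocks `g` and `b`. -/
def blockDiag (g : V → V → ℝ) (b : ι → ι → ℝ) : V ⊕ ι → V ⊕ ι → ℝ
  | Sum.inl x, Sum.inl y => g x y
  | Sum.inl _, Sum.inr _ => 0
  | Sum.inr _, Sum.inl _ => 0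
  | Sum.inr k, Sum.inr l => b k l

variable {G : SimpleGraph V} {v : V} {B : SimpleGraph ι} {H : SimpleGraph (V ⊕ ι)}

theorem IsConeGluing.inr_inl (h : IsConeGluing G v B H) (k : ι) (x : V) :
    H.Adj (Sum.inr k) (Sum.inl x) ↔ x = v := by
  rw [H.adj_comm, h.inl_inr]

theorem IsConeGluing.connected (h : IsConeGluing G v B H) (hG : G.Connected) : H.Connected := by
  have hl : ∀ x, H.Reachable (Sum.inl x) (Sum.inl v) := fun x =>
    (hG.preconnected x v).map ⟨Sum.inl, fun {a b} hab => (h.inl_inl a b).2 hab⟩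
  have hr : ∀ x, H.Reachable x (Sum.inl v) := by
    rintro (x | k)
    · exact hl x
    · exact ((h.inr_inl k v).2 rfl).reachable
  exact { preconnected := fun x y => (hr x).trans (hr y).symm
          nonempty := ⟨Sum.inl v⟩ }

variable [Fintype V] [Fintype ι]

open Classical in
theorem IsConeGluing.deg_inl (h : IsConeGluing G v B H) (x : V) :
    deg H (Sum.inl x) = deg G x + if x = v then (Fintype.card ι : ℝ) else 0 := by
  simp only [deg, Fintype.sum_sum_type, h.inl_inl, h.inl_inr]
  congr 1
  split_ifs <;> simp

theorem IsConeGluing.deg_inr (h : IsConeGluing G v B H) (k : ι) :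
    deg H (Sum.inr k) = 1 + deg B k := by
  classical
  simp only [deg, Fintype.sum_sum_type, h.inr_inl, h.inr_inr, Finset.sum_ite_eq',
    Finset.mem_univ, if_true]

theorem IsConeGluing.sum_deg (h : IsConeGluing G v B H) :
    ∑ x, deg H x = ∑ x, deg G x + Fintype.card ι + ∑ k, (1 + deg B k) := by
  classical
  simp [Fintype.sum_sum_type, h.deg_inl, h.deg_inr, Finset.sum_add_distrib]

open Classical in
theorem IsConeGluing.isGreen (h : IsConeGluing G v B H) {g : V → V → ℝ} (hg : IsGreen G v g)
    {b : ι → ι → ℝ} (hb : ∀ k l, lap B (fun z => b z l) k + b k l = if k = l then 1 else 0) :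
    IsGreen H (Sum.inl v) (blockDiag g b) := by
  refine ⟨?_, ?_⟩
  · rintro (x | k) (y | l)
    · have := hg.lap_eq x y
      simp only [lap] at this
      simp only [lap, Fintype.sum_sum_type, h.inl_inl, h.inl_inr, blockDiag, this,
        Sum.inl.injEq, add_eq_left]
      refine Finset.sum_eq_zero fun k _ => ?_
      split_ifs with hx
      · rw [hx, hg.ground, sub_zero]
      · rfl
    · have hs : ∑ k, b k l = 1 := by
        have := Finset.sum_congr rfl fun k (_ : k ∈ Finset.univ) => hb k l
        rw [Finset.sum_add_distrib, sum_lap] at this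
        simpa using this
      simp only [lap, Fintype.sum_sum_type, h.inl_inl, h.inl_inr, blockDiag, Sum.inl.injEq]
      by_cases hx : x = v <;> simp [hx, hs]
    · simp [lap, Fintype.sum_sum_type, h.inr_inl, h.inr_inr, blockDiag, hg.ground]
    · have := hb k l
      simp only [lap] at this
      simp only [lap, Fintype.sum_sum_type, h.inr_inl, h.inr_inr, blockDiag, Sum.inr.injEq]
      rw [← this, add_comm]
      simp
  · rintro (y | l)
    · exact hg.ground y
    · rfl

theorem IsConeGluing.greenTrace (h : IsConeGluing G v B H) {g : V → V → ℝ} (hg : IsGreen G v g)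
    (b : ι → ι → ℝ) :
    greenTrace H (blockDiag g b) = greenTrace G g + ∑ k, (1 + deg B k) * b k k := by
  classical
  simp [Kemeny.greenTrace, Fintype.sum_sum_type, h.deg_inl, h.deg_inr, blockDiag, add_mul,
    Finset.sum_add_distrib, hg.ground]

theorem IsConeGluing.greenForm (h : IsConeGluing G v B H) (hG : G.Connected)
    {g : V → V → ℝ} (hg : IsGreen G v g)
    (b : ι → ι → ℝ) :
    greenForm H (blockDiag g b) =
      greenForm G g + ∑ k, (1 + deg B k) * ∑ l, b k l * (1 + deg B l) := by
  classical
  -- Needed because gluing raises the degree of v: the column at v is harmonic and grounded, so it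
  -- vanishes.
  have hv : ∀ x, g x v = 0 := fun x => by
    rw [← hg.ground v]
    exact eq_of_lap_eq_zero hG (f := fun z => g z v) (fun y => by rw [hg.lap_eq, sub_self]) x v
  simp [Kemeny.greenForm, Fintype.sum_sum_type, h.deg_inl, h.deg_inr, blockDiag, add_mul, mul_add,
    Finset.sum_add_distrib, hg.ground, hv]

theorem IsConeGluing.deg_pos (h : IsConeGluing G v B H) (hG : G.Connected) [Nonempty ι]
    (x : V ⊕ ι) : 0 < deg H x := by
  have : Nontrivial (V ⊕ ι) := ⟨Sum.inl v, Sum.inr (Classical.arbitrary ι), by simp⟩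
  exact Kemeny.deg_pos (h.connected hG) x

open Classical in
/-- Kemeny's constant of a graph glued to `G` at `v`, in terms of the Green functions of the two
parts. -/
theorem IsConeGluing.isKemenyConstant (h : IsConeGluing G v B H) (hG : G.Connected) [Nonempty ι]
    {g : V → V → ℝ} (hg : IsGreen G v g) {b : ι → ι → ℝ}
    (hb : ∀ k l, lap B (fun z => b z l) k + b k l = if k = l then 1 else 0) {T S W : ℝ}
    (hT : ∑ k, (1 + deg B k) * b k k = T)
    (hS : ∑ k, (1 + deg B k) * ∑ l, b k l * (1 + deg B l) = S)
    (hW : Fintype.card ι + ∑ k, (1 + deg B k) = W) :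
    0 ≤ Kemeny.greenTrace G g + T - (Kemeny.greenForm G g + S) / (∑ x, deg G x + W) ∧
    IsKemenyConstant (walkMatrix H) (Real.toNNReal
      (Kemeny.greenTrace G g + T - (Kemeny.greenForm G g + S) / (∑ x, deg G x + W))) := by
  have := isKemenyConstant_of_isGreen (h.connected hG) (h.deg_pos hG) (h.isGreen hg hb)
  rwa [h.greenTrace hg, h.greenForm hG hg, h.sum_deg, add_assoc (∑ x, deg G x), hT, hS, hW] at this

end Gluing

/-! ### Explicit constants for the four graphs. -/

section PendantVertices

variable {V : Type*} (G : SimpleGraph V) (v : V)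

theorem isConeGluing_graphBar : IsConeGluing G v (⊥ : SimpleGraph (Fin 3)) (graphBar G v) :=
  ⟨fun _ _ => Iff.rfl, fun _ _ => Iff.rfl, fun _ _ => Iff.rfl⟩

variable {G v}

theorem IsConeGluing.sup_edge {ι : Type*} {B : SimpleGraph ι} {H : SimpleGraph (V ⊕ ι)}
    (h : IsConeGluing G v B H) (k l : ι) :
    IsConeGluing G v (B ⊔ SimpleGraph.edge k l)
      (H ⊔ SimpleGraph.edge (Sum.inr k) (Sum.inr l)) := by
  refine ⟨fun x y => ?_, fun x m => ?_, fun m n => ?_⟩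
  · simp [SimpleGraph.edge_adj, h.inl_inl]
  · simp [SimpleGraph.edge_adj, h.inl_inr]
  · simp [SimpleGraph.edge_adj, h.inr_inr]

variable (G v)

theorem isConeGluing_graphTilde :
    IsConeGluing G v (⊥ ⊔ SimpleGraph.edge (0 : Fin 3) 1) (graphTilde G v) :=
  (isConeGluing_graphBar G v).sup_edge 0 1

theorem isConeGluing_graphHat :
    IsConeGluing G v (⊥ ⊔ SimpleGraph.edge (0 : Fin 3) 1 ⊔ SimpleGraph.edge 1 2)
      (graphHat G v) :=
  (isConeGluing_graphTilde G v).sup_edge 1 2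

theorem isConeGluing_graphStar :
    IsConeGluing G v
      (⊥ ⊔ SimpleGraph.edge (0 : Fin 3) 1 ⊔ SimpleGraph.edge 1 2 ⊔ SimpleGraph.edge 0 2)
      (graphStar G v) :=
  (isConeGluing_graphHat G v).sup_edge 0 2

variable {G v} [Fintype V]

/-- Here and in the next three results, b is the inverse of I + L_B, and the number added to ∑ d_x
is twice the number of new edges. -/
theorem isKemenyConstant_graphBar (hG : G.Connected) {g : V → V → ℝ} (hg : IsGreen G v g) :
    0 ≤ greenTrace G g + 3 - (greenForm G g + 3) / (∑ x, deg G x + 6) ∧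
    IsKemenyConstant (walkMatrix (graphBar G v)) (Real.toNNReal
      (greenTrace G g + 3 - (greenForm G g + 3) / (∑ x, deg G x + 6))) := by
  refine (isConeGluing_graphBar G v).isKemenyConstant hG hg
    (b := !![1, 0, 0; 0, 1, 0; 0, 0, 1]) ?_ ?_ ?_ ?_
  · intro k l
    fin_cases k <;> fin_cases l <;> simp [lap]
  all_goals simp [deg, Fin.sum_univ_three]
  all_goals norm_num

theorem isKemenyConstant_graphTilde (hG : G.Connected) {g : V → V → ℝ} (hg : IsGreen G v g) :
    0 ≤ greenTrace G g + 11 / 3 - (greenForm G g + 9) / (∑ x, deg G x + 8) ∧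
    IsKemenyConstant (walkMatrix (graphTilde G v)) (Real.toNNReal
      (greenTrace G g + 11 / 3 - (greenForm G g + 9) / (∑ x, deg G x + 8))) := by
  refine (isConeGluing_graphTilde G v).isKemenyConstant hG hg
    (b := !![2/3, 1/3, 0; 1/3, 2/3, 0; 0, 0, 1]) ?_ ?_ ?_ ?_
  · intro k l
    fin_cases k <;> fin_cases l <;>
      simp [lap, Fin.sum_univ_three, SimpleGraph.edge_adj] <;> norm_num
  all_goals simp [deg, Fin.sum_univ_three, SimpleGraph.edge_adj, -Finset.sum_boole]
  all_goals norm_num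

theorem isKemenyConstant_graphHat (hG : G.Connected) {g : V → V → ℝ} (hg : IsGreen G v g) :
    0 ≤ greenTrace G g + 4 - (greenForm G g + 33 / 2) / (∑ x, deg G x + 10) ∧
    IsKemenyConstant (walkMatrix (graphHat G v)) (Real.toNNReal
      (greenTrace G g + 4 - (greenForm G g + 33 / 2) / (∑ x, deg G x + 10))) := by
  refine (isConeGluing_graphHat G v).isKemenyConstant hG hg
    (b := !![5/8, 1/4, 1/8; 1/4, 1/2, 1/4; 1/8, 1/4, 5/8]) ?_ ?_ ?_ ?_
  · intro k l
    fin_cases k <;> fin_cases l <;>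
      simp [lap, Fin.sum_univ_three, SimpleGraph.edge_adj] <;> norm_num
  all_goals simp [deg, Fin.sum_univ_three, SimpleGraph.edge_adj, -Finset.sum_boole]
  all_goals norm_num

theorem isKemenyConstant_graphStar (hG : G.Connected) {g : V → V → ℝ} (hg : IsGreen G v g) :
    0 ≤ greenTrace G g + 9 / 2 - (greenForm G g + 27) / (∑ x, deg G x + 12) ∧
    IsKemenyConstant (walkMatrix (graphStar G v)) (Real.toNNReal
      (greenTrace G g + 9 / 2 - (greenForm G g + 27) / (∑ x, deg G x + 12))) := by
  refine (isConeGluing_graphStar G v).isKemenyConstant hG hg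
    (b := !![1/2, 1/4, 1/4; 1/4, 1/2, 1/4; 1/4, 1/4, 1/2]) ?_ ?_ ?_ ?_
  · intro k l
    fin_cases k <;> fin_cases l <;>
      simp [lap, Fin.sum_univ_three, SimpleGraph.edge_adj] <;> norm_num
  all_goals simp [deg, Fin.sum_univ_three, SimpleGraph.edge_adj, -Finset.sum_boole]
  all_goals norm_num

end PendantVertices

/-! ### Edge counts and the path on two vertices. -/

section Edges

variable {V : Type*} [Fintype V] {G : SimpleGraph V}

open Classical in
theorem sum_deg (G : SimpleGraph V) : ∑ x, deg G x = 2 * (G.edgeSet.ncard : ℝ) := by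
  have h := G.sum_degrees_eq_twice_card_edges
  rw [Set.ncard_eq_toFinset_card', ← SimpleGraph.edgeFinset]
  simp only [deg_eq_degree]
  exact_mod_cast h

open Classical in
theorem deg_le_ncard_edgeSet (G : SimpleGraph V) (v : V) : deg G v ≤ G.edgeSet.ncard := by
  rw [Set.ncard_eq_toFinset_card', ← SimpleGraph.edgeFinset, deg_eq_degree]
  exact_mod_cast G.degree_le_card_edgeFinset v

theorem nontrivial_of_one_le_ncard_edgeSet (hm : 1 ≤ G.edgeSet.ncard) : Nontrivial V := by
  obtain ⟨e, he⟩ := (Set.ncard_pos (Set.toFinite _)).1 hm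
  induction e with
  | h x y => exact ⟨x, y, G.ne_of_adj he⟩

theorem card_eq_two_of_ncard_edgeSet (hG : G.Connected) (hm : G.edgeSet.ncard = 1) :
    Fintype.card V = 2 := by
  have h1 := hG.card_vert_le_card_edgeSet_add_one
  rw [Nat.card_coe_set_eq, hm, Nat.card_eq_fintype_card] at h1
  have := nontrivial_of_one_le_ncard_edgeSet hm.ge
  have := Fintype.one_lt_card (α := V)
  omega

theorem eq_of_ne_of_card_eq_two (hV : Fintype.card V = 2) {x y z : V} (hx : x ≠ z) (hy : y ≠ x) :
    y = z := by
  classical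
  by_contra hyz
  have h3 : ({x, y, z} : Finset V).card = 3 := Finset.card_eq_three.2 ⟨x, y, z, hy.symm, hx, hyz, rfl⟩
  have := Finset.card_le_univ ({x, y, z} : Finset V)
  omega

theorem eq_top_of_card_eq_two (hG : G.Connected) (hV : Fintype.card V = 2) : G = ⊤ := by
  have : Nontrivial V := Fintype.one_lt_card_iff_nontrivial.1 (by omega)
  ext x y
  refine ⟨fun h => h.ne, fun h => ?_⟩
  obtain ⟨z, hz⟩ := hG.preconnected.exists_adj_of_nontrivial x
  rwa [← eq_of_ne_of_card_eq_two hV (x := x) (y := z) (z := y) h hz.ne.symm]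

theorem nonempty_iso_pathGraph_two_iff (hG : G.Connected) :
    Nonempty (G ≃g SimpleGraph.pathGraph 2) ↔ G.edgeSet.ncard = 1 := by
  classical
  constructor
  · rintro ⟨e⟩
    have hV : Fintype.card V = 2 := by simpa using Fintype.card_congr e.toEquiv
    rw [Set.ncard_eq_toFinset_card', ← SimpleGraph.edgeFinset]
    have := eq_top_of_card_eq_two hG hV
    subst this
    have h := SimpleGraph.card_edgeFinset_top_eq_card_choose_two (V := V)
    rw [hV, Nat.choose_self] at h
    convert h
  · intro hm
    have hV := card_eq_two_of_ncard_edgeSet hG hm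
    rw [SimpleGraph.pathGraph_two_eq_top, eq_top_of_card_eq_two hG hV]
    exact ⟨SimpleGraph.Iso.completeGraph (Fintype.equivFinOfCardEq hV)⟩

end Edges

end Kemeny

/-! ### Comparison of the four constants. -/

theorem mainTheorem11 {V : Type*} [Fintype V] (G : SimpleGraph V) (hG : G.Connected) (v : V)
    (hm : 1 ≤ G.edgeSet.ncard) :
    ∃ κbar κtilde κhat κstar : NNReal,
      Kemeny.IsKemenyConstant (Kemeny.walkMatrix (Kemeny.graphBar G v)) κbar ∧
      Kemeny.IsKemenyConstant (Kemeny.walkMatrix (Kemeny.graphTilde G v)) κtilde ∧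
      Kemeny.IsKemenyConstant (Kemeny.walkMatrix (Kemeny.graphHat G v)) κhat ∧
      Kemeny.IsKemenyConstant (Kemeny.walkMatrix (Kemeny.graphStar G v)) κstar ∧
      κbar ≤ κstar ∧
      (κstar = κbar ↔ Nonempty (G ≃g SimpleGraph.pathGraph 2)) ∧
      κbar < κhat ∧
      (2 ≤ G.edgeSet.ncard → κhat < κstar) ∧
      (4 ≤ G.edgeSet.ncard → κtilde < κhat) ∧
      (4 ≤ G.edgeSet.ncard → κtilde < κstar) := by
  obtain ⟨g, hg⟩ := Kemeny.exists_isGreen hG v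
  have : Nontrivial V := Kemeny.nontrivial_of_one_le_ncard_edgeSet hm
  obtain ⟨b0, hb⟩ := Kemeny.isKemenyConstant_graphBar hG hg
  obtain ⟨t0, ht⟩ := Kemeny.isKemenyConstant_graphTilde hG hg
  obtain ⟨h0, hh⟩ := Kemeny.isKemenyConstant_graphHat hG hg
  obtain ⟨s0, hs⟩ := Kemeny.isKemenyConstant_graphStar hG hg
  refine ⟨_, _, _, _, hb, ht, hh, hs, ?_⟩
  have hS : (G.edgeSet.ncard : ℝ) ≤ Kemeny.greenForm G g := by
    have := Kemeny.sum_deg_sub_le_greenForm (fun x => Kemeny.deg_pos hG x) hg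
    rw [Kemeny.sum_deg] at this
    linarith [Kemeny.deg_le_ncard_edgeSet G v]
  have hS1 : G.edgeSet.ncard = 1 → Kemeny.greenForm G g = 1 := fun h => by
    have hV := Kemeny.card_eq_two_of_ncard_edgeSet hG h
    rw [Kemeny.greenForm_eq hg fun x y hx hxy => Kemeny.eq_of_ne_of_card_eq_two hV hx hxy.ne.symm,
      Kemeny.sum_deg, h]
    have h1 := Kemeny.deg_le_ncard_edgeSet G v
    have h2 := Kemeny.deg_pos hG v
    classical
    rw [Kemeny.deg_eq_degree] at h1 h2 ⊢
    rw [h] at h1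
    norm_cast at h1 h2
    have : G.degree v = 1 := by omega
    rw [this]
    norm_num
  rw [Kemeny.nonempty_iso_pathGraph_two_iff hG]
  rw [Kemeny.sum_deg] at *
  generalize G.edgeSet.ncard = m at *
  generalize Kemeny.greenForm G g = S at *
  generalize Kemeny.greenTrace G g = T at *
  have hm' : (1 : ℝ) ≤ m := by exact_mod_cast hm
  -- In `e1` to `e4` the coefficient of S is positive, so `hS` reduces each sign to a quadratic in
  -- m.
  have e1 : (T + 9 / 2 - (S + 27) / (2 * m + 12)) - (T + 3 - (S + 3) / (2 * m + 6)) =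
      3 * ((m : ℝ) ^ 2 + m + S - 3) / (2 * (m + 3) * (m + 6)) := by
    field_simp
    ring
  have e2 : (T + 4 - (S + 33 / 2) / (2 * m + 10)) - (T + 3 - (S + 3) / (2 * m + 6)) =
      (4 * (m : ℝ) ^ 2 + 5 * m + 4 * S - 9) / (4 * (m + 3) * (m + 5)) := by
    field_simp
    ring
  have e3 : (T + 9 / 2 - (S + 27) / (2 * m + 12)) - (T + 4 - (S + 33 / 2) / (2 * m + 10)) =
      (2 * (m : ℝ) ^ 2 + m + 2 * S - 12) / (4 * (m + 5) * (m + 6)) := by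
    field_simp
    ring
  have e4 : (T + 4 - (S + 33 / 2) / (2 * m + 10)) - (T + 11 / 3 - (S + 9) / (2 * m + 8)) =
      (4 * (m : ℝ) ^ 2 - 9 * m + 6 * S - 46) / (12 * (m + 4) * (m + 5)) := by
    field_simp
    ring
  have l3 : 2 ≤ m → (T + 4 - (S + 33 / 2) / (2 * m + 10)) <
      (T + 9 / 2 - (S + 27) / (2 * m + 12)) := fun h => by
    have h' : (2 : ℝ) ≤ m := by exact_mod_cast h
    rw [← sub_pos, e3]
    exact div_pos (by nlinarith) (by positivity)
  have l4 : 4 ≤ m → (T + 11 / 3 - (S + 9) / (2 * m + 8)) <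
      (T + 4 - (S + 33 / 2) / (2 * m + 10)) := fun h => by
    have h' : (4 : ℝ) ≤ m := by exact_mod_cast h
    rw [← sub_pos, e4]
    exact div_pos (by nlinarith) (by positivity)
  -- The constants are nonnegative, so `Real.toNNReal` truncates nothing.
  have hlt : ∀ {a b : ℝ}, 0 ≤ a → a < b → a.toNNReal < b.toNNReal := fun ha hab =>
    (Real.toNNReal_lt_toNNReal_iff (ha.trans_lt hab)).2 hab
  refine ⟨Real.toNNReal_le_toNNReal ?_, ?_, hlt b0 ?_, fun h => hlt h0 (l3 h),
    fun h => hlt t0 (l4 h), fun h => hlt t0 ((l4 h).trans (l3 (by omega)))⟩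
  · rw [← sub_nonneg, e1]
    exact div_nonneg (by nlinarith) (by positivity)
  · rw [Real.toNNReal_eq_toNNReal_iff s0 b0, ← sub_eq_zero, e1]
    -- The numerator m² + m + S − 3 is positive for m ≥ 2 and zero for m = S = 1.
    constructor
    · intro h
      by_contra hne
      have h' : (2 : ℝ) ≤ m := by exact_mod_cast (by omega : 2 ≤ m)
      exact (div_pos (by nlinarith) (by positivity)).ne' h
    · intro h
      rw [hS1 h, h]
      norm_num
  · rw [← sub_pos, e2]
    exact div_pos (by nlinarith) (by positivity)
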